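/- Two senders compete for two receivers. Each sender $i\in\{1,2\}$ has a private quality $u_i\in\{0,1\}$, drawn i.i.d. with $\Pr[u_i=1]=\lambda$, where $0<\lambda<1$. A signaling policy is a Borel probability measure $G$ on $[0,1]^2$ whose two one-dimensional marginals both have mean $\lambda$ (Bayes-plausibility). The senders use policies $G$ and $F$. Independent signals $q\sim G$ and $p\sim F$ are realized. Receiver $j$ selects the sender with the larger $j$-th coordinate, and if $q_j=p_j$ she selects either sender with probability $1/2$, independently of everything else. A sender selected by the set $S\subseteq\{1,2\}$ of receivers gets $V(S)$. A policy is a best response to $F$ if it maximizes the sender's expected utility against $F$ among all signaling policies. $(G,G)$ is a symmetric (pure-strategy Nash) equilibrium if $G$ is a best response to itself, and its welfare $\mathrm{WEL}(G,G)$ is the sum of the two senders' expected utilities. The price of stability is $$\Gamma(\lambda,V)=\frac{\max_{S\subseteq\{1,2\}}\bigl(V(S)+V(\{1,2\}\setminus S)\bigr)}{\sup\{\mathrm{WEL}(G,G):(G,G)\text{ a symmetric equilibrium}\}}.$$ **Theorem.** Let $V(S)=v(|S|)$ be anonymous strictly supermodular: $v(0)=0$ and $v$ is strictly increasing and strictly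 convex on $\{0,1,2\}$, i.e. $v(0)<v(1)<v(2)$ and $v(1)-v(0)<v(2)-v(1)$. Then for every $0<\lambda<1$ the set of welfares of symmetric equilibria is nonempty and bounded above, and: 1. If $\lambda\le 1/2$, then $\Gamma(\lambda,V)=1$ and the supremum is attained. In particular, let $G$ be the perfectly correlated policy that is uniform on the diagonal segment $\{(t,t):0\le t\le 2\lambda\}$. Then $(G,G)$ is an equilibrium, and its welfare equals the optimal welfare $\max_S\bigl(V(S)+V(\{1,2\}\setminus S)\bigr)$. 2. If $\lambda>1/2$, then $\Gamma(\lambda,V)>1$. -/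

import Mathlib

open MeasureTheory

noncomputable section

namespace Persuasion

/-- A realized signal profile of one sender: the vector of posterior means of his quality,
one entry in `[0,1]` for each of the `n` receivers. -/
abbrev Signal (n : ℕ) : Type := Fin n → unitInterval

/-- `G` is a signaling policy for prior `lam`: a Borel probability distribution on `[0,1]^n`
which is Bayes-plausible, i.e. each one-dimensional marginal has mean `lam`. -/
structure IsPolicy {n : ℕ} (lam : ℝ) (G : Measure (Signal n)) : Prop where
  isProbability : IsProbabilityMeasure G
  bayesPlausible : ∀ j, ∫ q, (q j : ℝ) ∂G = lam

/-- Receivers who strictly prefer the sender with signal `q` to the sender with signal `p`. -/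
def strictWins {n : ℕ} (q p : Signal n) : Finset (Fin n) :=
  Finset.univ.filter fun j => p j < q j

/-- Receivers who are indifferent between the two senders. -/
def ties {n : ℕ} (q p : Signal n) : Finset (Fin n) :=
  Finset.univ.filter fun j => p j = q j

/-- Expected utility of the sender with realized signal `q` against realized signal `p`.
Every receiver selects the sender with the larger signal, and each indifferent receiver selects
either sender with probability `1/2`, independently of the others. Hence the set `U` of
indifferent receivers that are won is uniform among the subsets of `ties q p`. -/
def signalUtility {n : ℕ} (V : Finset (Fin n) → ℝ) (q p : Signal n) : ℝ :=
  ∑ U ∈ (ties q p).powerset, (1 / 2 : ℝ) ^ (ties q p).card * V (strictWins q p ∪ U)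

/-- Expected utility of a sender with realized signal `q` when the other sender uses `F`. -/
def interimUtility {n : ℕ} (V : Finset (Fin n) → ℝ) (q : Signal n) (F : Measure (Signal n)) : ℝ :=
  ∫ p, signalUtility V q p ∂F

/-- Expected utility of a sender who uses `G` when the other sender uses `F`. -/
def utility {n : ℕ} (V : Finset (Fin n) → ℝ) (G F : Measure (Signal n)) : ℝ :=
  ∫ q, interimUtility V q F ∂G

/-- `G` is a best response to `F`. -/
def IsBestResponse {n : ℕ} (lam : ℝ) (V : Finset (Fin n) → ℝ) (G F : Measure (Signal n)) : Prop :=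
  IsPolicy lam G ∧ ∀ H : Measure (Signal n), IsPolicy lam H → utility V H F ≤ utility V G F

/-- `(G, F)` is a pure-strategy Nash equilibrium. -/
def IsEquilibrium {n : ℕ} (lam : ℝ) (V : Finset (Fin n) → ℝ) (G F : Measure (Signal n)) : Prop :=
  IsBestResponse lam V G F ∧ IsBestResponse lam V F G

/-- The senders' welfare: the sum of the two expected utilities. -/
def welfare {n : ℕ} (V : Finset (Fin n) → ℝ) (G F : Measure (Signal n)) : ℝ :=
  utility V G F + utility V F G

/-- The welfare values of all symmetric pure-strategy Nash equilibria. -/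
def equilibriumWelfares {n : ℕ} (lam : ℝ) (V : Finset (Fin n) → ℝ) : Set ℝ :=
  {w | ∃ G : Measure (Signal n), IsEquilibrium lam V G G ∧ w = welfare V G G}

/-- The welfare of an optimal outcome: the maximum over `S` of `V(S) + V([n] \ S)`. -/
def optimalWelfare {n : ℕ} (V : Finset (Fin n) → ℝ) : ℝ :=
  Finset.univ.sup' Finset.univ_nonempty fun S : Finset (Fin n) => V S + V Sᶜ

/-- The price of stability: optimal welfare divided by the best welfare of a symmetric
equilibrium. -/
def priceOfStability {n : ℕ} (lam : ℝ) (V : Finset (Fin n) → ℝ) : ℝ :=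
  optimalWelfare V / sSup (equilibriumWelfares lam V)

/-- `V` is an anonymous strictly supermodular utility function on sets of `n` receivers:
`V(S) = v(|S|)`, where `v` on `{0, ..., n}` satisfies `v(0) = 0`, is strictly increasing and
strictly convex (strictly increasing differences). -/
def IsAnonymousStrictlySupermodular {n : ℕ} (V : Finset (Fin n) → ℝ) : Prop :=
  ∃ v : ℕ → ℝ, v 0 = 0 ∧ (∀ k, k + 1 ≤ n → v k < v (k + 1)) ∧
    (∀ k, k + 2 ≤ n → v (k + 1) - v k < v (k + 2) - v (k + 1)) ∧
    ∀ S, V S = v S.card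

/-- The perfectly correlated policy under which all receivers get the same signal, uniform on
`[0, 2 lam]`. -/
def diagonalPolicy (n : ℕ) (lam : ℝ) : Measure (Signal n) :=
  (ProbabilityTheory.cond (volume : Measure unitInterval) {t | (t : ℝ) ≤ 2 * lam}).map
    fun t _ => t

end Persuasion

end

open ProbabilityTheory

namespace Persuasion

/-! Write `a = v 1` and `k = v 2 - 2 * v 1 > 0`. Ties are broken independently, so the payoff of a
signal pair is `a * (w₀ + w₁) + k * w₀ * w₁`, where `wⱼ` is the probability of winning receiver `j`.
The opponent wins with probabilities `1 - wⱼ`, so the two payoffs sum to `2a + k - k * (w₀ * (1 -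
w₁) + w₁ * (1 - w₀))`. Welfare is lost exactly when the receivers may be split, and a tie at either
receiver costs `k / 2`.

Equilibria come from a linear majorant. If the interim utility against a policy is at most `b * (q 0
+ q 1)`, Bayes-plausibility caps every deviation at `2 * b * lam`, and a policy supported where
equality holds attains the cap. A uniform law on the diagonal, possibly with an atom at `(1, 1)`,
has this property. Without the atom ties are null and welfare is optimal, but the mean is then at
most `1 / 2`.

For `lam > 1 / 2`, full revelation is a profitable deviation unless the policy often ties with
itself at signal `1`. Every symmetric equilibrium therefore has an atom at `1` in some coordinate,
of mass at least `1 - 1 / (2 * lam)`. The resulting tie loss is uniform over equilibria, so it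
survives passing to the supremum. -/

/-- The probability that a receiver selects the sender with signal `x` over the one with
signal `y`. -/
noncomputable def winProb (x y : unitInterval) : ℝ := if y < x then 1 else if y = x then 1 / 2 else 0

theorem winProb_of_lt {x y : unitInterval} (h : y < x) : winProb x y = 1 := if_pos h

theorem winProb_self (x : unitInterval) : winProb x x = 1 / 2 := by simp [winProb]

theorem winProb_of_gt {x y : unitInterval} (h : x < y) : winProb x y = 0 := by
  simp [winProb, h.le.not_gt, h.ne']

theorem winProb_nonneg (x y : unitInterval) : 0 ≤ winProb x y := by
  unfold winProb; split_ifs <;> norm_num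

theorem winProb_le_one (x y : unitInterval) : winProb x y ≤ 1 := by
  unfold winProb; split_ifs <;> norm_num

theorem winProb_swap (x y : unitInterval) : winProb y x = 1 - winProb x y := by
  rcases lt_trichotomy x y with h | rfl | h
  · rw [winProb_of_lt h, winProb_of_gt h]; norm_num
  · rw [winProb_self]; norm_num
  · rw [winProb_of_lt h, winProb_of_gt h]; norm_num

theorem measurable_winProb : Measurable fun z : unitInterval × unitInterval => winProb z.1 z.2 :=
  Measurable.ite (measurableSet_lt measurable_snd measurable_fst) measurable_const
    (Measurable.ite (measurableSet_eq_fun measurable_snd measurable_fst) measurable_const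
      measurable_const)

/-- On subsets of two receivers, `v |S|` is a linear term in the two winning indicators plus `v 2 -
2 * v 1` times their product. The indicators are independent given the signals, so expectations
replace them. This formula is all that the later payoff estimates use about `V`. -/
theorem signalUtility_eq {V : Finset (Fin 2) → ℝ} {v : ℕ → ℝ} (h0 : v 0 = 0)
    (hv : ∀ S, V S = v S.card) (q p : Signal 2) :
    signalUtility V q p = v 1 * (winProb (q 0) (p 0) + winProb (q 1) (p 1)) +
      (v 2 - 2 * v 1) * (winProb (q 0) (p 0) * winProb (q 1) (p 1)) := by
  have hu : (Finset.univ : Finset (Fin 2)) = {0, 1} := rfl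
  have h01 : ({0, 1} : Finset (Fin 2)).card = 2 := rfl
  have h10 : ({1, 0} : Finset (Fin 2)).card = 2 := rfl
  have hp0 : ({0} : Finset (Fin 2)).powerset = {∅, {0}} := rfl
  have hp1 : ({1} : Finset (Fin 2)).powerset = {∅, {1}} := rfl
  have hp2 : ({0, 1} : Finset (Fin 2)).powerset = {∅, {0}, {1}, {0, 1}} := rfl
  have e0 : (∅ : Finset (Fin 2)) ≠ {0} := by decide
  have e1 : (∅ : Finset (Fin 2)) ≠ {1} := by decide
  have e2 : (∅ : Finset (Fin 2)) ∉ ({{0}, {1}, {0, 1}} : Finset (Finset (Fin 2))) := by decide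
  have e3 : ({0} : Finset (Fin 2)) ∉ ({{1}, {0, 1}} : Finset (Finset (Fin 2))) := by decide
  have e4 : ({1} : Finset (Fin 2)) ≠ {0, 1} := by decide
  -- Each alternative decides both the strict-win and the tie predicate, so `simp` can evaluate the
  -- filters in all nine cases.
  have key : ∀ x y : unitInterval, (x < y ∧ x ≠ y) ∨ (x = y ∧ ¬ x < y) ∨ (¬ x < y ∧ x ≠ y) := by
    intro x y
    by_cases h : x < y
    · exact Or.inl ⟨h, h.ne⟩
    · by_cases h' : x = y
      · exact Or.inr (Or.inl ⟨h', h⟩)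
      · exact Or.inr (Or.inr ⟨h, h'⟩)
  unfold signalUtility ties strictWins winProb
  rcases key (p 0) (q 0) with ⟨h, g⟩ | ⟨h, g⟩ | ⟨h, g⟩ <;>
  rcases key (p 1) (q 1) with ⟨h', g'⟩ | ⟨h', g'⟩ | ⟨h', g'⟩ <;>
  simp only [hu, hv, h0, h, h', g, g', Finset.filter_insert, Finset.filter_singleton, if_true,
    if_false, h01, h10, hp0, hp1, hp2, Finset.sum_pair e0, Finset.sum_pair e1,
    Finset.sum_insert e2, Finset.sum_insert e3, Finset.sum_pair e4, Finset.powerset_empty,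
    Finset.sum_singleton, Finset.card_empty, Finset.card_singleton, Finset.union_empty,
    Finset.empty_union, lt_self_iff_false, LawfulSingleton.insert_empty_eq,
    Finset.singleton_union] <;>
  ring

/-! ### Payoff bounds and the welfare loss from ties -/

section Supermodular

variable {V : Finset (Fin 2) → ℝ} {a k : ℝ}
  (hs : ∀ q p, signalUtility V q p = a * (winProb (q 0) (p 0) + winProb (q 1) (p 1)) +
    k * (winProb (q 0) (p 0) * winProb (q 1) (p 1)))
  (ha : 0 < a) (hk : 0 < k)
include hs

theorem measurable_signalUtility :
    Measurable fun z : Signal 2 × Signal 2 => signalUtility V z.1 z.2 := by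
  have h (j : Fin 2) : Measurable fun z : Signal 2 × Signal 2 => winProb (z.1 j) (z.2 j) :=
    measurable_winProb.comp (f := fun z : Signal 2 × Signal 2 => (z.1 j, z.2 j)) (by fun_prop)
  simp only [hs]
  exact (((h 0).add (h 1)).const_mul a).add (((h 0).mul (h 1)).const_mul k)

include ha hk

theorem signalUtility_nonneg (q p : Signal 2) : 0 ≤ signalUtility V q p := by
  rw [hs]
  have := winProb_nonneg (q 0) (p 0)
  have := winProb_nonneg (q 1) (p 1)
  positivity

theorem signalUtility_le (q p : Signal 2) : signalUtility V q p ≤ 2 * a + k := by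
  rw [hs]
  have h0 := winProb_nonneg (q 0) (p 0)
  have h1 := winProb_le_one (q 0) (p 0)
  have h2 := winProb_le_one (q 1) (p 1)
  have h3 : winProb (q 0) (p 0) * winProb (q 1) (p 1) ≤ 1 := by nlinarith
  nlinarith

theorem integrable_signalUtility (G F : Measure (Signal 2)) [IsProbabilityMeasure G]
    [IsProbabilityMeasure F] :
    Integrable (fun z : Signal 2 × Signal 2 => signalUtility V z.1 z.2) (G.prod F) := by
  refine Integrable.of_bound (measurable_signalUtility hs).aestronglyMeasurable (2 * a + k)
    (Filter.Eventually.of_forall fun z => ?_)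
  rw [Real.norm_of_nonneg (signalUtility_nonneg hs ha hk _ _)]
  exact signalUtility_le hs ha hk _ _

theorem integrable_signalUtility_right (q : Signal 2) (F : Measure (Signal 2))
    [IsProbabilityMeasure F] : Integrable (signalUtility V q) F := by
  refine Integrable.of_bound
    ((measurable_signalUtility hs).comp measurable_prodMk_left).aestronglyMeasurable (2 * a + k)
    (Filter.Eventually.of_forall fun z => ?_)
  rw [Real.norm_of_nonneg (signalUtility_nonneg hs ha hk _ _)]
  exact signalUtility_le hs ha hk _ _

theorem integrable_interimUtility (G F : Measure (Signal 2)) [IsProbabilityMeasure G]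
    [IsProbabilityMeasure F] : Integrable (fun q => interimUtility V q F) G :=
  (integrable_signalUtility hs ha hk G F).integral_prod_left

theorem interimUtility_nonneg (q : Signal 2) (F : Measure (Signal 2)) :
    0 ≤ interimUtility V q F :=
  integral_nonneg fun p => signalUtility_nonneg hs ha hk q p

/-- When both signals to receiver `j` equal `1`, `wⱼ = 1 / 2` and the splitting loss is `k / 2`
whatever happens at the other receiver. Two independent draws do this with probability `G.real {q |
q j = 1} ^ 2`; elsewhere the loss is merely nonnegative. -/
theorem welfare_le (G : Measure (Signal 2)) [IsProbabilityMeasure G] (j : Fin 2) :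
    welfare V G G ≤ 2 * a + k - k / 2 * G.real {q | q j = 1} ^ 2 := by
  have hA : MeasurableSet {q : Signal 2 | q j = 1} :=
    measurableSet_eq_fun (measurable_pi_apply j) measurable_const
  have hi := integrable_signalUtility hs ha hk G G
  have hu : utility V G G = ∫ z, signalUtility V z.1 z.2 ∂(G.prod G) := (integral_prod _ hi).symm
  -- Swapping the draws turns the same utility into the opponent's payoff, so welfare is the
  -- integral of a pointwise sum.
  have hu' : utility V G G = ∫ z, signalUtility V z.2 z.1 ∂(G.prod G) := by
    rw [hu, ← integral_prod_swap]; rfl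
  have hi' : Integrable (fun z : Signal 2 × Signal 2 => signalUtility V z.2 z.1) (G.prod G) :=
    hi.swap
  have hB := hA.prod hA
  have hint : Integrable (({q : Signal 2 | q j = 1} ×ˢ {q : Signal 2 | q j = 1}).indicator
      fun _ => k / 2) (G.prod G) := (integrable_const _).indicator hB
  have hval : ∫ z, (2 * a + k) - ({q : Signal 2 | q j = 1} ×ˢ {q : Signal 2 | q j = 1}).indicator
      (fun _ => k / 2) z ∂(G.prod G) = 2 * a + k - k / 2 * G.real {q | q j = 1} ^ 2 := by
    rw [integral_sub (integrable_const _) hint, integral_indicator_const _ hB,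
      measureReal_prod_prod]
    simp
    ring
  rw [welfare, ← hval]
  nth_rw 1 [hu]
  rw [hu', ← integral_add hi hi']
  refine integral_mono (hi.add hi') ((integrable_const _).sub hint) fun z => ?_
  simp only [hs]
  rw [winProb_swap (z.1 0), winProb_swap (z.1 1)]
  have h0 := winProb_nonneg (z.1 0) (z.2 0)
  have h1 := winProb_le_one (z.1 0) (z.2 0)
  have h2 := winProb_nonneg (z.1 1) (z.2 1)
  have h3 := winProb_le_one (z.1 1) (z.2 1)
  by_cases hz : z ∈ {q : Signal 2 | q j = 1} ×ˢ {q : Signal 2 | q j = 1}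
  · have hw : winProb (z.1 j) (z.2 j) = 1 / 2 := by rw [hz.1, hz.2, winProb_self]
    rw [Set.indicator_of_mem hz]
    fin_cases j <;> simp only [Fin.zero_eta, Fin.mk_one] at hw <;> rw [hw] <;> linarith
  · rw [Set.indicator_of_notMem hz]
    nlinarith [mul_nonneg hk.le (mul_nonneg h0 (sub_nonneg.2 h3)),
      mul_nonneg hk.le (mul_nonneg h2 (sub_nonneg.2 h1))]

end Supermodular

/-! ### Mixtures and full revelation -/

/-- The convex combination `(1 - t) μ + t ν`. -/
noncomputable def mix {α : Type*} [MeasurableSpace α] (t : ℝ) (μ ν : Measure α) : Measure α :=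
  ENNReal.ofReal (1 - t) • μ + ENNReal.ofReal t • ν

section Mix

variable {α : Type*} [MeasurableSpace α] {t : ℝ} (ht0 : 0 ≤ t) (ht1 : t ≤ 1) (μ ν : Measure α)
include ht0 ht1

theorem isProbabilityMeasure_mix [IsProbabilityMeasure μ] [IsProbabilityMeasure ν] :
    IsProbabilityMeasure (mix t μ ν) := by
  refine ⟨?_⟩
  simp only [mix, Measure.add_apply, Measure.smul_apply, measure_univ, smul_eq_mul, mul_one]
  rw [← ENNReal.ofReal_add (by linarith) ht0]
  simp

theorem integral_mix {f : α → ℝ} (hμ : Integrable f μ) (hν : Integrable f ν) :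
    ∫ x, f x ∂(mix t μ ν) = (1 - t) * ∫ x, f x ∂μ + t * ∫ x, f x ∂ν := by
  rw [mix, integral_add_measure (hμ.smul_measure ENNReal.ofReal_ne_top)
    (hν.smul_measure ENNReal.ofReal_ne_top), integral_smul_measure, integral_smul_measure,
    ENNReal.toReal_ofReal (by linarith), ENNReal.toReal_ofReal ht0, smul_eq_mul, smul_eq_mul]

end Mix

theorem integrable_coord (G : Measure (Signal 2)) [IsProbabilityMeasure G] (j : Fin 2) :
    Integrable (fun q : Signal 2 => (q j : ℝ)) G := by
  refine Integrable.of_bound (measurable_subtype_coe.comp (measurable_pi_apply j)).aestronglyMeasurable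
    1 (Filter.Eventually.of_forall fun q => ?_)
  rw [Real.norm_of_nonneg (q j).2.1]
  exact (q j).2.2

/-- The policy that reveals the quality to both receivers. -/
noncomputable def fullRevelation (lam : ℝ) : Measure (Signal 2) :=
  mix lam (Measure.dirac fun _ => 0) (Measure.dirac fun _ => 1)

theorem isPolicy_fullRevelation {lam : ℝ} (h0 : 0 ≤ lam) (h1 : lam ≤ 1) :
    IsPolicy lam (fullRevelation lam) := by
  refine ⟨isProbabilityMeasure_mix h0 h1 _ _, fun j => ?_⟩
  rw [fullRevelation, integral_mix h0 h1 _ _ (integrable_coord _ j) (integrable_coord _ j)]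
  simp

/-! ### Forced ties at the top when `lam > 1 / 2` -/

section Supermodular

variable {V : Finset (Fin 2) → ℝ} {a k : ℝ}
  (hs : ∀ q p, signalUtility V q p = a * (winProb (q 0) (p 0) + winProb (q 1) (p 1)) +
    k * (winProb (q 0) (p 0) * winProb (q 1) (p 1)))
  (ha : 0 < a) (hk : 0 < k)
include hs ha hk

/-- The signal `(1, 1)` wins everything except ties at `1`. One tie costs `(a + k) / 2` and two cost
`a + 3k / 4`, so charging `(2a + k) / 2` per tie suffices. -/
theorem le_interimUtility_one (G : Measure (Signal 2)) [IsProbabilityMeasure G] :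
    (2 * a + k) * (1 - (G.real {q | q 0 = 1} + G.real {q | q 1 = 1}) / 2) ≤
      interimUtility V (fun _ => 1) G := by
  have hA (j : Fin 2) : MeasurableSet {q : Signal 2 | q j = 1} :=
    measurableSet_eq_fun (measurable_pi_apply j) measurable_const
  have hint (j : Fin 2) : Integrable ({q : Signal 2 | q j = 1}.indicator
      fun _ => (2 * a + k) / 2) G := (integrable_const _).indicator (hA j)
  have hint' : Integrable (fun p => (2 * a + k) - {q : Signal 2 | q 0 = 1}.indicator
      (fun _ => (2 * a + k) / 2) p) G := (integrable_const _).sub (hint 0)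
  have hval : ∫ p, ((2 * a + k) - {q : Signal 2 | q 0 = 1}.indicator (fun _ => (2 * a + k) / 2) p) -
      {q : Signal 2 | q 1 = 1}.indicator (fun _ => (2 * a + k) / 2) p ∂G =
      (2 * a + k) * (1 - (G.real {q | q 0 = 1} + G.real {q | q 1 = 1}) / 2) := by
    rw [integral_sub hint' (hint 1),
      integral_sub (integrable_const _) (hint 0), integral_indicator_const _ (hA 0),
      integral_indicator_const _ (hA 1)]
    simp
    ring
  have hw (x : unitInterval) : (x = 1 ∧ winProb 1 x = 1 / 2) ∨ (x ≠ 1 ∧ winProb 1 x = 1) := by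
    by_cases h : x = 1
    · exact Or.inl ⟨h, by rw [h, winProb_self]⟩
    · exact Or.inr ⟨h, winProb_of_lt (unitInterval.lt_one_iff_ne_one.2 h)⟩
  rw [← hval]
  refine integral_mono (hint'.sub (hint 1))
    (integrable_signalUtility_right hs ha hk _ G) fun p => ?_
  simp only [hs, Set.indicator_apply, Set.mem_ofPred_eq]
  rcases hw (p 0) with ⟨h, e⟩ | ⟨h, e⟩ <;> rcases hw (p 1) with ⟨h', e'⟩ | ⟨h', e'⟩ <;>
    simp only [h, h', e, e', winProb_self, if_true, if_false] <;> linarith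

/-- In a symmetric equilibrium, full revelation cannot be a profitable deviation, which forces
the policy to tie with itself at the top signal. -/
theorem le_measureReal_top_of_isEquilibrium {lam : ℝ} (hlam0 : 0 < lam) (hlam1 : lam < 1)
    {G : Measure (Signal 2)} (hG : IsEquilibrium lam V G G) :
    2 - 1 / lam ≤ G.real {q | q 0 = 1} + G.real {q | q 1 = 1} := by
  have := hG.1.1.isProbability
  have h1 := hG.1.2 _ (isPolicy_fullRevelation hlam0.le hlam1.le)
  -- By symmetry each sender gets half of the welfare.
  have h2 : utility V G G ≤ (2 * a + k) / 2 := by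
    have := welfare_le hs ha hk G 0
    rw [welfare] at this
    nlinarith [mul_nonneg hk.le (sq_nonneg (G.real {q | q 0 = 1}))]
  rw [utility, fullRevelation, integral_mix hlam0.le hlam1.le _ _
    (integrable_interimUtility hs ha hk _ G) (integrable_interimUtility hs ha hk _ G),
    integral_dirac, integral_dirac] at h1
  have h3 := interimUtility_nonneg hs ha hk (fun _ => 0) G
  have h4 := le_interimUtility_one hs ha hk G
  set g := G.real {q | q 0 = 1} + G.real {q | q 1 = 1}
  have h5 : lam * ((2 * a + k) * (1 - g / 2)) ≤ (2 * a + k) / 2 := by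
    have := mul_le_mul_of_nonneg_left h4 hlam0.le
    have := mul_nonneg (sub_nonneg.2 hlam1.le) h3
    linarith
  have h6 : lam * (1 - g / 2) ≤ 1 / 2 := by
    by_contra! h
    nlinarith
  have h7 : 2 * lam - 1 ≤ lam * g := by linarith
  rw [show 2 - 1 / lam = (2 * lam - 1) / lam by field_simp, div_le_iff₀ hlam0]
  linarith

theorem welfare_le_of_isEquilibrium {lam : ℝ} (hlam0 : 1 / 2 < lam) (hlam1 : lam < 1)
    {G : Measure (Signal 2)} (hG : IsEquilibrium lam V G G) :
    welfare V G G ≤ 2 * a + k - k / 2 * (1 - 1 / (2 * lam)) ^ 2 := by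
  have := hG.1.1.isProbability
  have hl : 0 < lam := by linarith
  have h := le_measureReal_top_of_isEquilibrium hs ha hk hl hlam1 hG
  have hd : 0 < 1 - 1 / (2 * lam) := by
    rw [sub_pos, div_lt_one (by linarith)]
    linarith
  have hd2 : 2 - 1 / lam = 2 * (1 - 1 / (2 * lam)) := by field_simp
  rw [hd2] at h
  have key : ∀ j, 1 - 1 / (2 * lam) ≤ G.real {q | q j = 1} →
      welfare V G G ≤ 2 * a + k - k / 2 * (1 - 1 / (2 * lam)) ^ 2 := fun j hj => by
    have h1 := welfare_le hs ha hk G j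
    have h2 := mul_le_mul_of_nonneg_left (pow_le_pow_left₀ hd.le hj 2) (half_pos hk).le
    linarith
  rcases le_total (G.real {q | q 0 = 1}) (G.real {q | q 1 = 1}) with h' | h'
  · exact key 1 (by linarith)
  · exact key 0 (by linarith)

end Supermodular

/-! ### Uniform laws on `[0, c]` -/

/-- The uniform distribution on `[0, c]`. -/
noncomputable def uniformOn (c : unitInterval) : Measure unitInterval :=
  cond volume (Set.Iic c)

theorem ae_uniformOn_le (c : unitInterval) : ∀ᵐ x ∂(uniformOn c), x ≤ c :=
  ae_cond_mem measurableSet_Iic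

theorem ae_uniformOn_ne (c y : unitInterval) : ∀ᵐ x ∂(uniformOn c), x ≠ y :=
  (cond_absolutelyContinuous (μ := volume)).ae_le (Measure.ae_ne volume y)

section Uniform

variable {c : unitInterval} (hc : 0 < c)
include hc

theorem isProbabilityMeasure_uniformOn : IsProbabilityMeasure (uniformOn c) :=
  cond_isProbabilityMeasure (by
    rw [unitInterval.volume_Iic]
    simpa using hc)

theorem integral_coe_uniformOn : ∫ x, (x : ℝ) ∂(uniformOn c) = c / 2 := by
  have hc' : (0 : ℝ) < c := hc
  have h1 : ∫ x in Set.Iic c, (x : ℝ) = (c : ℝ) ^ 2 / 2 := by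
    have h := unitInterval.measurePreserving_coe.setIntegral_preimage_emb
      unitInterval.measurableEmbedding_coe (fun y : ℝ => y) (Set.Iic (c : ℝ))
    have hset : Set.Iic (c : ℝ) ∩ unitInterval = Set.Icc 0 (c : ℝ) := by
      ext y
      exact ⟨fun hy => ⟨hy.2.1, hy.1⟩, fun hy => ⟨hy.2, hy.1, hy.2.trans c.2.2⟩⟩
    rw [Measure.restrict_restrict measurableSet_Iic, hset, integral_Icc_eq_integral_Ioc,
      ← intervalIntegral.integral_of_le hc'.le, integral_id] at h
    rw [show Set.Iic c = Subtype.val ⁻¹' Set.Iic (c : ℝ) from rfl, h]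
    ring
  rw [uniformOn, ProbabilityTheory.cond, integral_smul_measure, h1, unitInterval.volume_Iic, ENNReal.toReal_inv,
    ENNReal.toReal_ofReal hc'.le, smul_eq_mul]
  field_simp

theorem integral_winProb_uniformOn (x : unitInterval) :
    ∫ t, winProb x t ∂(uniformOn c) = min (x : ℝ) c / c := by
  have hc' : (0 : ℝ) < c := hc
  have h1 : (fun t => winProb x t) =ᵐ[uniformOn c] (Set.Iio x).indicator fun _ => (1 : ℝ) := by
    filter_upwards [ae_uniformOn_ne c x] with t ht
    simp [winProb, Set.indicator_apply, ht]
  have h2 : (volume : Measure unitInterval) (Set.Iic c ∩ Set.Iio x) =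
      ENNReal.ofReal (min (x : ℝ) c) := by
    rcases lt_or_ge c x with h | h
    · rw [Set.inter_eq_left.2 (Set.Iic_subset_Iio.2 h), unitInterval.volume_Iic,
        min_eq_right (show (c : ℝ) ≤ x from h.le)]
    · rw [Set.inter_eq_right.2 (Set.Iio_subset_Iic_self.trans (Set.Iic_subset_Iic.2 h)), unitInterval.volume_Iio,
        min_eq_left (show (x : ℝ) ≤ c from h)]
  rw [integral_congr_ae h1, integral_indicator_const _ measurableSet_Iio, Measure.real, uniformOn,
    cond_apply measurableSet_Iic, h2, unitInterval.volume_Iic, ENNReal.toReal_mul,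
    ENNReal.toReal_inv, ENNReal.toReal_ofReal hc'.le,
    ENNReal.toReal_ofReal (le_min x.2.1 hc'.le), smul_eq_mul, mul_one]
  field_simp

/-- Off the null set of ties, both `x` and `y` beat the common signal `t` exactly when `min x y`
does. -/
theorem integral_winProb_mul_winProb_uniformOn (x y : unitInterval) :
    ∫ t, winProb x t * winProb y t ∂(uniformOn c) = min (min (x : ℝ) y) c / c := by
  have h := integral_winProb_uniformOn hc (min x y)
  rw [← Monotone.map_min (f := Subtype.val) (fun _ _ h => h), ← h]
  refine integral_congr_ae ?_
  filter_upwards [ae_uniformOn_ne c x, ae_uniformOn_ne c y] with t hx hy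
  simp only [winProb, hx, hy, if_false, lt_min_iff]
  by_cases h1 : t < x <;> by_cases h2 : t < y <;> by_cases h3 : t = min x y <;>
    simp [h1, h2, h3]
  all_goals rcases min_choice x y with h | h <;> simp_all

end Uniform

/-! ### Diagonal equilibria with an atom at the top -/

/-- The perfectly correlated policy which sends the signal `1` to both receivers with
probability `t`, and otherwise a common signal that is uniform on `[0, c]`. -/
noncomputable def atomDiagonal (t : ℝ) (c : unitInterval) : Measure (Signal 2) :=
  mix t ((uniformOn c).map fun x _ => x) (Measure.dirac fun _ => 1)

theorem measurable_diagonal : Measurable fun (x : unitInterval) (_ : Fin 2) => x :=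
  measurable_pi_lambda _ fun _ => measurable_id

section Diagonal

variable {t : ℝ} {c : unitInterval} (ht0 : 0 ≤ t) (ht1 : t ≤ 1) (hc : 0 < c)
include hc

theorem isProbabilityMeasure_map_uniformOn :
    IsProbabilityMeasure ((uniformOn c).map fun (x : unitInterval) (_ : Fin 2) => x) :=
  have := isProbabilityMeasure_uniformOn hc
  Measure.isProbabilityMeasure_map measurable_diagonal.aemeasurable

include ht0 ht1

theorem isPolicy_atomDiagonal : IsPolicy ((1 - t) * (c / 2) + t) (atomDiagonal t c) := by
  have := isProbabilityMeasure_map_uniformOn hc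
  refine ⟨isProbabilityMeasure_mix ht0 ht1 _ _, fun j => ?_⟩
  rw [atomDiagonal, integral_mix ht0 ht1 _ _ (integrable_coord _ j) (integrable_coord _ j),
    integral_map measurable_diagonal.aemeasurable (integrable_coord _ j).aestronglyMeasurable,
    integral_coe_uniformOn hc]
  simp

variable {V : Finset (Fin 2) → ℝ} {a k : ℝ}
  (hs : ∀ q p, signalUtility V q p = a * (winProb (q 0) (p 0) + winProb (q 1) (p 1)) +
    k * (winProb (q 0) (p 0) * winProb (q 1) (p 1)))
  (ha : 0 < a) (hk : 0 < k)
include hs ha hk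

theorem interimUtility_atomDiagonal (q : Signal 2) :
    interimUtility V q (atomDiagonal t c) =
      (1 - t) * (a * (min (q 0 : ℝ) c / c + min (q 1 : ℝ) c / c) +
        k * (min (min (q 0 : ℝ) (q 1)) c / c)) +
      t * (a * (winProb (q 0) 1 + winProb (q 1) 1) + k * (winProb (q 0) 1 * winProb (q 1) 1)) := by
  have := isProbabilityMeasure_map_uniformOn hc
  have := isProbabilityMeasure_uniformOn hc
  have hm (x : unitInterval) : Measurable fun y => winProb x y :=
    measurable_winProb.comp measurable_prodMk_left
  have hi (x : unitInterval) : Integrable (fun y => winProb x y) (uniformOn c) := by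
    refine Integrable.of_bound (hm x).aestronglyMeasurable 1 (Filter.Eventually.of_forall fun y => ?_)
    rw [Real.norm_of_nonneg (winProb_nonneg _ _)]
    exact winProb_le_one _ _
  have hi2 (x y : unitInterval) : Integrable (fun z => winProb x z * winProb y z) (uniformOn c) := by
    refine Integrable.of_bound ((hm x).mul (hm y)).aestronglyMeasurable 1
      (Filter.Eventually.of_forall fun z => ?_)
    rw [Real.norm_of_nonneg (mul_nonneg (winProb_nonneg _ _) (winProb_nonneg _ _))]
    exact mul_le_one₀ (winProb_le_one _ _) (winProb_nonneg _ _) (winProb_le_one _ _)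
  have hi3 : Integrable (fun z => winProb (q 0) z + winProb (q 1) z) (uniformOn c) :=
    (hi _).add (hi _)
  have hr := integrable_signalUtility_right hs ha hk q
  rw [interimUtility, atomDiagonal, integral_mix ht0 ht1 _ _ (hr _) (hr _), integral_dirac,
    integral_map measurable_diagonal.aemeasurable (hr _).aestronglyMeasurable]
  simp only [hs]
  rw [integral_add (hi3.const_mul a) ((hi2 _ _).const_mul k), integral_const_mul,
    integral_const_mul, integral_add (hi _) (hi _), integral_winProb_uniformOn hc,
    integral_winProb_uniformOn hc, integral_winProb_mul_winProb_uniformOn hc]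

-- `b` is the slope per coordinate that makes the linear majorant exact on the diagonal up to `c`
-- (away from the signal `1`).
variable {b : ℝ} (hb : b = (1 - t) * (2 * a + k) / (2 * c))
include hb

/-- The joint terms are dominated by separable ones that agree with them on the diagonal, leaving a
one-variable bound in each coordinate. `hle` is that bound at the signal `1`. -/
theorem interimUtility_atomDiagonal_le
    (hle : (1 - t) * (2 * a + k) / 2 + t * (a + k / 4) / 2 ≤ b) (q : Signal 2) :
    interimUtility V q (atomDiagonal t c) ≤ b * (q 0 + q 1) := by
  have hc' : (0 : ℝ) < c := hc
  rw [interimUtility_atomDiagonal ht0 ht1 hc hs ha hk]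
  have hg (x : unitInterval) : (1 - t) * ((2 * a + k) / 2) * (min (x : ℝ) c / c) +
      t * (a + k / 4) * winProb x 1 ≤ b * x := by
    by_cases hx : x = 1
    · rw [hx, winProb_self, Set.Icc.coe_one, min_eq_right c.2.2, div_self hc'.ne']
      linarith
    · rw [winProb_of_gt (unitInterval.lt_one_iff_ne_one.2 hx)]
      have h1 : min (x : ℝ) c / c ≤ x / c := by gcongr; exact min_le_left _ _
      have h2 : b * x = (1 - t) * ((2 * a + k) / 2) * (x / c) := by rw [hb]; field_simp
      rw [h2, mul_zero, add_zero]
      exact mul_le_mul_of_nonneg_left h1 (mul_nonneg (by linarith) (by linarith))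
  have hw (x : unitInterval) : winProb x 1 ≤ 1 / 2 := by
    rcases unitInterval.le_one' (t := x) |>.lt_or_eq with h | h
    · rw [winProb_of_gt h]; norm_num
    · rw [h, winProb_self]
  have hmin : min (min (q 0 : ℝ) (q 1)) c / c ≤
      (min (q 0 : ℝ) c / c + min (q 1 : ℝ) c / c) / 2 := by
    have h1 : min (min (q 0 : ℝ) (q 1)) c / c ≤ min (q 0 : ℝ) c / c := by
      gcongr; exact min_le_left _ _
    have h2 : min (min (q 0 : ℝ) (q 1)) c / c ≤ min (q 1 : ℝ) c / c := by
      gcongr; exact min_le_right _ _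
    linarith
  -- Against signal `1` each win probability is at most `1 / 2`; equality holds when both are `0` or
  -- both are `1 / 2`.
  have hprod : winProb (q 0) 1 * winProb (q 1) 1 ≤ (winProb (q 0) 1 + winProb (q 1) 1) / 4 := by
    nlinarith [hw (q 0), hw (q 1), winProb_nonneg (q 0) 1, winProb_nonneg (q 1) 1]
  have h3 := mul_le_mul_of_nonneg_left hmin (mul_nonneg (sub_nonneg.2 ht1) hk.le)
  have h4 := mul_le_mul_of_nonneg_left hprod (mul_nonneg ht0 hk.le)
  linarith [hg (q 0), hg (q 1)]

-- The majorant must be exact at `(1, 1)` only if the atom has mass; the factor `t` lets the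
-- atomless case `t = 0` be covered too.
variable (heq : t * ((1 - t) * (2 * a + k) / 2 + t * (a + k / 4) / 2) = t * b)
include heq

theorem utility_atomDiagonal_self :
    utility V (atomDiagonal t c) (atomDiagonal t c) = 2 * b * ((1 - t) * (c / 2) + t) := by
  have hc' : (0 : ℝ) < c := hc
  have := isProbabilityMeasure_map_uniformOn hc
  have hP := isPolicy_atomDiagonal ht0 ht1 hc
  have := hP.isProbability
  have hi (G : Measure (Signal 2)) [IsProbabilityMeasure G] :=
    integrable_interimUtility hs ha hk G (atomDiagonal t c)
  have h1 : ∫ q, interimUtility V q (atomDiagonal t c)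
      ∂((uniformOn c).map fun (x : unitInterval) (_ : Fin 2) => x) = b * c := by
    rw [integral_map measurable_diagonal.aemeasurable (hi _).aestronglyMeasurable]
    have hae : (fun x : unitInterval => interimUtility V (fun _ => x) (atomDiagonal t c))
        =ᵐ[uniformOn c] fun x => 2 * b * (x : ℝ) := by
      filter_upwards [ae_uniformOn_le c, ae_uniformOn_ne c 1] with x hx hx1
      rw [interimUtility_atomDiagonal ht0 ht1 hc hs ha hk,
        winProb_of_gt (unitInterval.lt_one_iff_ne_one.2 hx1), min_self,
        min_eq_left (show (x : ℝ) ≤ c from hx), hb]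
      field_simp
      ring
    rw [integral_congr_ae hae, integral_const_mul, integral_coe_uniformOn hc]
    ring
  have h2 : t * interimUtility V (fun _ => 1) (atomDiagonal t c) = t * (2 * b) := by
    rw [interimUtility_atomDiagonal ht0 ht1 hc hs ha hk, winProb_self, Set.Icc.coe_one, min_self,
      min_eq_right c.2.2, div_self hc'.ne']
    linear_combination 2 * heq
  have h3 : utility V (atomDiagonal t c) (atomDiagonal t c) =
      ∫ q, interimUtility V q (atomDiagonal t c)
        ∂(mix t ((uniformOn c).map fun x _ => x) (Measure.dirac fun _ => 1)) := rfl
  rw [h3, integral_mix ht0 ht1 _ _ (hi _) (hi _), integral_dirac, h1, h2]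
  ring

theorem isEquilibrium_atomDiagonal {lam : ℝ}
    (hle : (1 - t) * (2 * a + k) / 2 + t * (a + k / 4) / 2 ≤ b)
    (hlam : lam = (1 - t) * (c / 2) + t) :
    IsEquilibrium lam V (atomDiagonal t c) (atomDiagonal t c) := by
  have hP := isPolicy_atomDiagonal ht0 ht1 hc
  rw [← hlam] at hP
  have := hP.isProbability
  suffices h : IsBestResponse lam V (atomDiagonal t c) (atomDiagonal t c) from ⟨h, h⟩
  refine ⟨hP, fun H hH => ?_⟩
  have := hH.isProbability
  rw [utility_atomDiagonal_self ht0 ht1 hc hs ha hk hb heq, ← hlam]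
  have hsum := (integrable_coord H 0).add (integrable_coord H 1)
  calc utility V H (atomDiagonal t c) ≤ ∫ q, b * ((q 0 : ℝ) + q 1) ∂H :=
        integral_mono (integrable_interimUtility hs ha hk H _) (hsum.const_mul b)
          (interimUtility_atomDiagonal_le ht0 ht1 hc hs ha hk hb hle)
    _ = 2 * b * lam := by
        rw [integral_const_mul, integral_add (integrable_coord H 0) (integrable_coord H 1),
          hH.bayesPlausible, hH.bayesPlausible]
        ring

end Diagonal

theorem atomDiagonal_zero {lam : ℝ} {c : unitInterval} (hc : (c : ℝ) = 2 * lam) :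
    atomDiagonal 0 c = diagonalPolicy 2 lam := by
  have h : Set.Iic c = {t : unitInterval | (t : ℝ) ≤ 2 * lam} := by
    rw [← hc]; rfl
  simp [atomDiagonal, mix, diagonalPolicy, uniformOn, h]

theorem optimalWelfare_eq {V : Finset (Fin 2) → ℝ} {v : ℕ → ℝ} (h0 : v 0 = 0)
    (hv : ∀ S, V S = v S.card) (h : 2 * v 1 ≤ v 2) : optimalWelfare V = v 2 := by
  refine le_antisymm (Finset.sup'_le _ _ fun S _ => ?_) ?_
  · have hS : S.card ≤ 2 := S.card_le_univ
    rw [hv, hv, Finset.card_compl, Fintype.card_fin]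
    interval_cases S.card <;> (norm_num [h0]; try linarith)
  · refine le_trans (le_of_eq ?_) (Finset.le_sup' _ (Finset.mem_univ Finset.univ))
    simp [hv, h0]

/-! ### Existence of equilibria for every prior -/

section Supermodular

variable {V : Finset (Fin 2) → ℝ} {a k : ℝ}
  (hs : ∀ q p, signalUtility V q p = a * (winProb (q 0) (p 0) + winProb (q 1) (p 1)) +
    k * (winProb (q 0) (p 0) * winProb (q 1) (p 1)))
  (ha : 0 < a) (hk : 0 < k)
include hs ha hk

theorem isEquilibrium_diagonalPolicy {lam : ℝ} (hlam0 : 0 < lam) (hlam1 : lam ≤ 1 / 2) :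
    IsEquilibrium lam V (diagonalPolicy 2 lam) (diagonalPolicy 2 lam) ∧
      welfare V (diagonalPolicy 2 lam) (diagonalPolicy 2 lam) = 2 * a + k := by
  let c : unitInterval := ⟨2 * lam, by linarith, by linarith⟩
  have hcv : (c : ℝ) = 2 * lam := rfl
  have hc : 0 < c := show (0 : ℝ) < 2 * lam by linarith
  -- Without an atom, the majorant condition at the top reduces to `c ≤ 1`, that is, `lam ≤ 1 / 2`.
  have hle : (1 - 0) * (2 * a + k) / 2 + 0 * (a + k / 4) / 2 ≤
      (1 - 0) * (2 * a + k) / (2 * (c : ℝ)) := by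
    rw [zero_mul, zero_div, add_zero, hcv]
    gcongr; linarith
  have heq : (0 : ℝ) * ((1 - 0) * (2 * a + k) / 2 + 0 * (a + k / 4) / 2) =
      0 * ((1 - 0) * (2 * a + k) / (2 * (c : ℝ))) := by simp
  rw [← atomDiagonal_zero hcv]
  refine ⟨isEquilibrium_atomDiagonal le_rfl zero_le_one hc hs ha hk rfl heq hle
    (by rw [hcv]; ring), ?_⟩
  rw [welfare, utility_atomDiagonal_self le_rfl zero_le_one hc hs ha hk rfl heq, hcv]
  field_simp
  ring

theorem exists_isEquilibrium_of_half_lt {lam : ℝ} (hlam0 : 1 / 2 < lam) (hlam1 : lam < 1) :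
    ∃ G, IsEquilibrium lam V G G ∧ 0 < welfare V G G := by
  -- `d t` is the payoff of `(1, 1)`. Exactness of the majorant there forces `b = d t / 2`, hence `c
  -- = (1 - t) * (2 * a + k) / d t`.
  let d : ℝ → ℝ := fun t => (1 - t) * (2 * a + k) + t * (a + k / 4)
  have hd : ∀ t ∈ Set.Icc (0 : ℝ) 1, 0 < d t := fun t ht => by
    have h1 := mul_nonneg (sub_nonneg.2 ht.2) (show 0 ≤ a + 3 * k / 4 by linarith)
    have h2 : d t = (1 - t) * (a + 3 * k / 4) + (a + k / 4) := by simp only [d]; ring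
    linarith
  -- `f t` is the mean of the policy with atom `t` and this `c`. It runs continuously from `1 / 2`
  -- to `1`, so some `t` gives mean `lam`.
  let f : ℝ → ℝ := fun t => (1 - t) * ((1 - t) * (2 * a + k) / d t / 2) + t
  have hf : ContinuousOn f (Set.Icc 0 1) := by
    have h1 : ContinuousOn (fun t => (1 - t) * (2 * a + k) / d t) (Set.Icc 0 1) :=
      ContinuousOn.div (by fun_prop) (by fun_prop) fun t ht => (hd t ht).ne'
    fun_prop
  have hf0 : f 0 = 1 / 2 := by
    have : 2 * a + k ≠ 0 := by positivity
    simp [f, d, this]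
  have hf1 : f 1 = 1 := by simp [f]
  obtain ⟨t, ht, hft⟩ := intermediate_value_Icc zero_le_one hf
    (show lam ∈ Set.Icc (f 0) (f 1) from ⟨by linarith, by linarith⟩)
  have ht1 : t < 1 := lt_of_le_of_ne ht.2 fun h => by rw [h, hf1] at hft; linarith
  have hdt := hd t ht
  have hn : 0 < (1 - t) * (2 * a + k) := mul_pos (by linarith) (by linarith)
  let c : unitInterval := ⟨(1 - t) * (2 * a + k) / d t, by positivity, by
    rw [div_le_one hdt]
    have := mul_nonneg ht.1 (show 0 ≤ a + k / 4 by linarith)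
    simp only [d]; linarith⟩
  have hcv : (c : ℝ) = (1 - t) * (2 * a + k) / d t := rfl
  have hc : 0 < c := show 0 < (1 - t) * (2 * a + k) / d t by positivity
  have hbd : (1 - t) * (2 * a + k) / 2 + t * (a + k / 4) / 2 =
      (1 - t) * (2 * a + k) / (2 * c) := by
    have h1 : (1 - t) * (2 * a + k) / (2 * c) = d t / 2 := by
      rw [hcv, div_eq_div_iff (by positivity) two_ne_zero]
      field_simp
    rw [h1]; simp only [d]; ring
  have hlam : lam = (1 - t) * ((c : ℝ) / 2) + t := hft.symm
  refine ⟨atomDiagonal t c, isEquilibrium_atomDiagonal ht.1 ht.2 hc hs ha hk rfl (by rw [hbd])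
    hbd.le hlam, ?_⟩
  rw [welfare, utility_atomDiagonal_self ht.1 ht.2 hc hs ha hk rfl (by rw [hbd]), ← hlam]
  have hc' : (0 : ℝ) < c := hc
  positivity

theorem welfare_le_of_isProbabilityMeasure (G : Measure (Signal 2)) [IsProbabilityMeasure G] :
    welfare V G G ≤ 2 * a + k :=
  (welfare_le hs ha hk G 0).trans (sub_le_self _ (by positivity))

end Supermodular

end Persuasion

theorem mainTheorem1 (V : Finset (Fin 2) → ℝ)
    (hV : Persuasion.IsAnonymousStrictlySupermodular V)
    (lam : ℝ) (hlam0 : 0 < lam) (hlam1 : lam < 1) :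
    ((Persuasion.equilibriumWelfares lam V).Nonempty ∧
      BddAbove (Persuasion.equilibriumWelfares lam V)) ∧
    (lam ≤ 1 / 2 →
      Persuasion.priceOfStability lam V = 1 ∧
      Persuasion.IsEquilibrium lam V (Persuasion.diagonalPolicy 2 lam)
        (Persuasion.diagonalPolicy 2 lam) ∧
      Persuasion.welfare V (Persuasion.diagonalPolicy 2 lam) (Persuasion.diagonalPolicy 2 lam) =
        Persuasion.optimalWelfare V ∧
      IsGreatest (Persuasion.equilibriumWelfares lam V) (Persuasion.optimalWelfare V)) ∧
    (1 / 2 < lam → 1 < Persuasion.priceOfStability lam V) := by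
  obtain ⟨v, h0, hmono, hconv, hv⟩ := hV
  have ha : 0 < v 1 := by simpa [h0] using hmono 0 (by norm_num)
  have hk : 0 < v 2 - 2 * v 1 := by
    have : v 1 - v 0 < v 2 - v 1 := hconv 0 le_rfl
    linarith
  have hs := Persuasion.signalUtility_eq h0 hv
  have hopt := Persuasion.optimalWelfare_eq h0 hv (by linarith)
  have hbound : ∀ w ∈ Persuasion.equilibriumWelfares lam V, w ≤ v 2 := by
    rintro w ⟨G, hG, rfl⟩
    have := hG.1.1.isProbability
    linarith [Persuasion.welfare_le_of_isProbabilityMeasure hs ha hk G]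
  have hlow (h : lam ≤ 1 / 2) := Persuasion.isEquilibrium_diagonalPolicy hs ha hk hlam0 h
  have hhigh (h : 1 / 2 < lam) := Persuasion.exists_isEquilibrium_of_half_lt hs ha hk h hlam1
  refine ⟨⟨?_, v 2, hbound⟩, fun h => ?_, fun h => ?_⟩
  · rcases le_or_gt lam (1 / 2) with h | h
    · exact ⟨_, _, (hlow h).1, rfl⟩
    · obtain ⟨G, hG, -⟩ := hhigh h
      exact ⟨_, G, hG, rfl⟩
  · obtain ⟨heq, hw⟩ := hlow h
    have hw' : Persuasion.welfare V (Persuasion.diagonalPolicy 2 lam)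
        (Persuasion.diagonalPolicy 2 lam) = Persuasion.optimalWelfare V := by
      rw [hw, hopt]; ring
    have hgr : IsGreatest (Persuasion.equilibriumWelfares lam V) (Persuasion.optimalWelfare V) :=
      ⟨⟨_, heq, hw'.symm⟩, fun w hw => hopt ▸ hbound w hw⟩
    refine ⟨?_, heq, hw', hgr⟩
    rw [Persuasion.priceOfStability, hgr.csSup_eq, hopt, div_self (by linarith)]
  · obtain ⟨G, hG, hpos⟩ := hhigh h
    have hmem : Persuasion.welfare V G G ∈ Persuasion.equilibriumWelfares lam V := ⟨G, hG, rfl⟩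
    -- The price of stability divides by this supremum, so the ratio comparison needs it positive;
    -- this is why an equilibrium of positive welfare is exhibited.
    have hsup_pos := hpos.trans_le (le_csSup ⟨v 2, hbound⟩ hmem)
    -- The supremum need not be known to be attained, so the gap below `v 2` has to depend on `lam`
    -- and `V` alone.
    have hsup_le : sSup (Persuasion.equilibriumWelfares lam V) ≤
        2 * v 1 + (v 2 - 2 * v 1) - (v 2 - 2 * v 1) / 2 * (1 - 1 / (2 * lam)) ^ 2 := by
      refine csSup_le ⟨_, hmem⟩ ?_
      rintro w ⟨F, hF, rfl⟩
      exact Persuasion.welfare_le_of_isEquilibrium hs ha hk h hlam1 hF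
    have hgap : 0 < 1 - 1 / (2 * lam) := by
      rw [sub_pos, div_lt_one (by linarith)]
      linarith
    have := mul_pos (half_pos hk) (pow_pos hgap 2)
    rw [Persuasion.priceOfStability, one_lt_div hsup_pos, hopt]
    linarith
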